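/- Let $G$ be a finitely generated free abelian group, $G^{\star}=\mathrm{Hom}(G,\mathbb{Z})$. For a submonoid $M$ of $G$, let $M^{\mathrm{gp}}$ be the subgroup it generates. A prime ideal of $M$ is a (possibly empty) subset $\mathfrak{p}\subseteq M$ with $M+\mathfrak{p}\subseteq\mathfrak{p}$ such that $M\setminus\mathfrak{p}$ is a submonoid. A convex cone in $G$ is a finitely generated submonoid $M\subseteq G$ which is saturated (if $x\in M^{\mathrm{gp}}$ and $nx\in M$ for some integer $n\ge 1$, then $x\in M$), has no units other than $0$, and for which $G/M^{\mathrm{gp}}$ is torsion free. A fan in $G$ is a nonempty, possibly infinite, collection $\triangle$ of convex cones in $G$ such that (1) $P\setminus\mathfrak{p}\in\triangle$ for all $P\in\triangle$ and all prime ideals $\mathfrak{p}$ of $P$; (2) for all $P,Q\in\triangle$ one has $P\cap Q=P\setminus\mathfrak{p}=Q\setminus\mathfrak{q}$ for some prime ideals $\mathfrak{p}$ of $P$ and $\mathfrak{q}$ of $Q$. For $P\in\triangle$ put $\check{P}=\{\sigma\in G^{\star}: \sigma(x)\ge 0 \text{ for all } x\in P\}$. For a commutative ring $R$ with identity, let $X_{\triangle}(R)$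 be the toric scheme over $R$ obtained by gluing the affine schemes $U_P=\mathrm{Spec}\,R[\check{P}]$, $P\in\triangle$, where $U_P$ and $U_Q$ are glued along their common open subscheme $U_{P\cap Q}$ (the open immersions $U_{P\cap Q}\to U_P$ and $U_{P\cap Q}\to U_Q$ being induced by the inclusions of $\check{P}$ and $\check{Q}$ in $(P\cap Q)^{\vee}$). **Theorem.** For every finitely generated free abelian group $G$, every fan $\triangle$ in $G$ and every commutative ring $R$, the toric scheme $X_{\triangle}(R)$ is separated over $R$. -/

import Mathlib

universe u

namespace Toric

/-- The subgroup of `G` generated by `M`; it is the Grothendieck group of the monoid `M`. -/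
def gp {G : Type u} [AddCommGroup G] (M : AddSubmonoid G) : AddSubgroup G :=
  AddSubgroup.closure (M : Set G)

/-- Convex cones in `G`: finitely generated saturated submonoids `M` of `G` without nonzero
units, such that the quotient of `G` by the group generated by `M` is torsion free. -/
structure IsConvexCone {G : Type u} [AddCommGroup G] (M : AddSubmonoid G) : Prop where
  fg : M.FG
  saturated : ∀ x ∈ gp M, ∀ n : ℕ, 0 < n → n • x ∈ M → x ∈ M
  pointed : ∀ x ∈ M, -x ∈ M → x = 0
  torsionFree : ∀ x : G ⧸ gp M, ∀ n : ℕ, 0 < n → n • x = 0 → x = 0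

/-- Prime ideals of the monoid `M`: subsets `p` of `M` with `M + p ⊆ p` whose complement in `M`
is a submonoid. The empty set is allowed. -/
structure IsPrimeIdeal {G : Type u} [AddCommGroup G] (M : AddSubmonoid G) (p : Set G) : Prop where
  subset : p ⊆ M
  add_mem : ∀ x ∈ M, ∀ y ∈ p, x + y ∈ p
  zero_notMem : (0 : G) ∉ p
  add_notMem : ∀ x ∈ M, ∀ y ∈ M, x ∉ p → y ∉ p → x + y ∉ p

/-- `F = M - p` for some prime ideal `p` of the monoid `M`. -/
def IsPrimeCompl {G : Type u} [AddCommGroup G] (F M : AddSubmonoid G) : Prop :=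
  ∃ p : Set G, IsPrimeIdeal M p ∧ (F : Set G) = (M : Set G) \ p

/-- Fans in `G`. The collection of cones may be infinite. -/
structure Fan (G : Type u) [AddCommGroup G] where
  cones : Set (AddSubmonoid G)
  nonempty : cones.Nonempty
  isConvexCone : ∀ P ∈ cones, IsConvexCone P
  primeCompl_mem : ∀ P ∈ cones, ∀ F : AddSubmonoid G, IsPrimeCompl F P → F ∈ cones
  inter : ∀ P ∈ cones, ∀ Q ∈ cones, IsPrimeCompl (P ⊓ Q) P ∧ IsPrimeCompl (P ⊓ Q) Q

/-- The dual monoid of `P`: the `σ : G → ℤ` with `σ x ≥ 0` for all `x ∈ P`. -/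
def dual {G : Type u} [AddCommGroup G] (P : AddSubmonoid G) : AddSubmonoid (Module.Dual ℤ G) where
  carrier := {σ | ∀ x ∈ P, 0 ≤ σ x}
  zero_mem' := fun _ _ => le_rfl
  add_mem' := fun ha hb x hx => add_nonneg (ha x hx) (hb x hx)

lemma dual_anti {G : Type u} [AddCommGroup G] {P Q : AddSubmonoid G} (h : P ≤ Q) :
    dual Q ≤ dual P := fun _ hσ x hx => hσ x (h hx)

section Separation

variable {G : Type u} [AddCommGroup G]

lemma exists_pos_of_nsmul_notMem [Module.Finite ℤ G] (K : AddSubgroup G) (y : G)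
    (hy : ∀ n : ℕ, 0 < n → n • y ∉ K) :
    ∃ w : Module.Dual ℤ G, (∀ k ∈ K, w k = 0) ∧ 0 < w y := by
  let N : Submodule ℤ G := AddSubgroup.toIntSubmodule K
  let T := (G ⧸ N) ⧸ Submodule.torsion ℤ (G ⧸ N)
  let q : G →ₗ[ℤ] T := (Submodule.torsion ℤ (G ⧸ N)).mkQ ∘ₗ N.mkQ
  have hq : q y ≠ 0 := by
    intro h
    have h1 : N.mkQ y ∈ Submodule.torsion ℤ (G ⧸ N) :=
      (Submodule.Quotient.mk_eq_zero _).1 h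
    rw [Submodule.mem_torsion_iff] at h1
    obtain ⟨a, ha⟩ := h1
    have ha0 : (a : ℤ) ≠ 0 := nonZeroDivisors.coe_ne_zero a
    have h2 : (a : ℤ) • y ∈ K := by
      have : N.mkQ ((a : ℤ) • y) = 0 := by rw [map_smul]; exact ha
      exact (Submodule.Quotient.mk_eq_zero N).1 this
    apply hy (a : ℤ).natAbs (by omega)
    rcases Int.natAbs_eq (a : ℤ) with h | h
    · rw [← natCast_zsmul, ← h]; exact h2
    · have : ((a : ℤ).natAbs : ℤ) = -(a : ℤ) := by omega
      rw [← natCast_zsmul, this, neg_smul]; exact K.neg_mem h2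
  have : ∃ f : Module.Dual ℤ T, f (q y) ≠ 0 := by
    by_contra! hcon
    exact hq ((Module.forall_dual_apply_eq_zero_iff ℤ (q y)).1 hcon)
  obtain ⟨f, hf⟩ := this
  have hK : ∀ k ∈ K, q k = 0 := by
    intro k hk
    have : N.mkQ k = 0 := (Submodule.Quotient.mk_eq_zero N).2 hk
    simp only [q, LinearMap.comp_apply, this, map_zero]
  rcases lt_or_gt_of_ne hf with h | h
  · exact ⟨-(f ∘ₗ q), fun k hk => by simp [hK k hk], by simpa using h⟩
  · exact ⟨f ∘ₗ q, fun k hk => by simp [hK k hk], by simpa using h⟩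

lemma gordan [Module.Finite ℤ G] (S : Finset G) (K : AddSubgroup G) :
    (∃ w : Module.Dual ℤ G, (∀ k ∈ K, w k = 0) ∧ ∀ x ∈ S, 0 < w x) ∨
      ∃ x ∈ S, ∃ z ∈ AddSubmonoid.closure (S : Set G), x + z ∈ K := by
  classical
  induction S using Finset.induction_on generalizing K with
  | empty => exact Or.inl ⟨0, by simp, by simp⟩
  | insert y S hyS ih =>
    have hmono : AddSubmonoid.closure (S : Set G) ≤
        AddSubmonoid.closure ((insert y S : Finset G) : Set G) :=
      AddSubmonoid.closure_mono (by simp)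
    have hyc : y ∈ AddSubmonoid.closure ((insert y S : Finset G) : Set G) :=
      AddSubmonoid.subset_closure (by simp)
    rcases ih (K ⊔ AddSubgroup.zmultiples y) with ⟨w, hwK, hw⟩ | ⟨x, hx, z, hz, hxz⟩
    · by_cases hy : ∀ n : ℕ, 0 < n → n • y ∉ K
      · left
        obtain ⟨v, hvK, hv⟩ := exists_pos_of_nsmul_notMem K y hy
        have hwy : w y = 0 := hwK y (AddSubgroup.mem_sup_right (AddSubgroup.mem_zmultiples y))
        refine ⟨(1 + ∑ x ∈ S, |v x|) • w + v, fun k hk => ?_, fun x hx => ?_⟩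
        · simp [hwK k (AddSubgroup.mem_sup_left hk), hvK k hk]
        · rcases Finset.mem_insert.1 hx with rfl | hx
          · simpa [hwy] using hv
          · have h1 : |v x| ≤ ∑ x ∈ S, |v x| :=
              Finset.single_le_sum (f := fun x => |v x|) (fun _ _ => abs_nonneg _) hx
            have h2 := hw x hx
            have h3 := neg_abs_le (v x)
            simp only [LinearMap.add_apply, LinearMap.smul_apply, smul_eq_mul]
            nlinarith [abs_nonneg (v x)]
      · right
        push Not at hy
        obtain ⟨n, hn, hny⟩ := hy
        refine ⟨y, by simp, (n - 1) • y, AddSubmonoid.nsmul_mem _ hyc _, ?_⟩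
        have : y + (n - 1) • y = n • y := by
          rw [← succ_nsmul', Nat.sub_add_cancel hn]
        rwa [this]
    · rw [AddSubgroup.mem_sup] at hxz
      obtain ⟨k, hk, m, hm, hkm⟩ := hxz
      obtain ⟨t, rfl⟩ := AddSubgroup.mem_zmultiples_iff.1 hm
      rcases le_or_gt t 0 with ht | ht
      · right
        refine ⟨x, by simp [hx], z + (-t).toNat • y,
          AddSubmonoid.add_mem _ (hmono hz) (AddSubmonoid.nsmul_mem _ hyc _), ?_⟩
        have h1 : (-t).toNat • y = -(t • y) := by
          rw [← natCast_zsmul, Int.toNat_of_nonneg (by omega), neg_smul]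
        have h2 : x + (z + (-t).toNat • y) = k := by
          rw [h1, ← add_assoc, ← hkm]; abel
        rwa [h2]
      · rcases ih K with ⟨w, hwK, hw⟩ | ⟨x', hx', z', hz', hxz'⟩
        · left
          refine ⟨w, hwK, fun x' hx' => ?_⟩
          rcases Finset.mem_insert.1 hx' with rfl | hx'
          · have hz0 : z ∈ (AddSubmonoid.nonneg ℤ).comap w.toAddMonoidHom :=
              (AddSubmonoid.closure_le (S := (AddSubmonoid.nonneg ℤ).comap
                w.toAddMonoidHom)).2 (fun a ha => (hw a ha).le) hz
            replace hz0 : 0 ≤ w z := hz0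
            have h1 := congrArg w hkm
            simp only [map_add, hwK k hk, map_zsmul, zero_add, smul_eq_mul] at h1
            have h2 := hw x hx
            by_contra hcon
            nlinarith
          · exact hw x' hx'
        · exact Or.inr ⟨x', by simp [hx'], z', hmono hz', hxz'⟩

/-- The complement of a prime ideal of a finitely generated `P` is cut out by an element of the
dual monoid. -/
lemma exists_support [Module.Finite ℤ G] {F P : AddSubmonoid G} (hP : P.FG)
    (h : IsPrimeCompl F P) :
    ∃ w ∈ dual P, ∀ x ∈ P, w x = 0 ↔ x ∈ F := by
  classical
  obtain ⟨p, hp, hF⟩ := h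
  have hFm : ∀ x, x ∈ F ↔ x ∈ P ∧ x ∉ p := fun x => by
    rw [← SetLike.mem_coe, hF]; simp
  obtain ⟨S, hS⟩ := hP
  have hSP : ∀ x ∈ S, x ∈ P := fun x hx => hS ▸ AddSubmonoid.subset_closure hx
  rcases gordan (S.filter (· ∈ p)) (AddSubgroup.closure (F : Set G)) with
    ⟨w, hwK, hw⟩ | ⟨x, hx, z, hz, hxz⟩
  · have hwF : ∀ x ∈ F, w x = 0 := fun x hx => hwK x (AddSubgroup.subset_closure hx)
    have key : ∀ x ∈ P, 0 ≤ w x ∧ (x ∈ p → 0 < w x) := by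
      intro x hx
      rw [← hS] at hx
      induction hx using AddSubmonoid.closure_induction with
      | mem a ha =>
        by_cases hap : a ∈ p
        · have := hw a (by simpa using ⟨ha, hap⟩)
          exact ⟨this.le, fun _ => this⟩
        · have := hwF a ((hFm a).2 ⟨hSP a ha, hap⟩)
          exact ⟨this.ge, fun h => absurd h hap⟩
      | zero => exact ⟨by simp, fun h => absurd h hp.zero_notMem⟩
      | add a b ha hb iha ihb =>
        rw [hS] at ha hb
        rw [map_add]
        refine ⟨add_nonneg iha.1 ihb.1, fun h => ?_⟩
        by_cases hap : a ∈ p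
        · exact add_pos_of_pos_of_nonneg (iha.2 hap) ihb.1
        · by_cases hbp : b ∈ p
          · exact add_pos_of_nonneg_of_pos iha.1 (ihb.2 hbp)
          · exact absurd h (hp.add_notMem a ha b hb hap hbp)
    refine ⟨w, fun x hx => (key x hx).1, fun x hx => ⟨fun h0 => ?_, hwF x⟩⟩
    exact (hFm x).2 ⟨hx, fun hxp => absurd ((key x hx).2 hxp) (by omega)⟩
  · exfalso
    rw [Finset.mem_filter] at hx
    have hzP : z ∈ P := by
      rw [← hS]
      exact AddSubmonoid.closure_mono (Finset.coe_subset.2 (Finset.filter_subset _ _)) hz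
    have hxz' : x + z ∈ p := by rw [add_comm]; exact hp.add_mem z hzP x hx.2
    have hdiff : ∀ g ∈ AddSubgroup.closure (F : Set G), ∃ a ∈ F, ∃ b ∈ F, g + a = b := by
      intro g hg
      induction hg using AddSubgroup.closure_induction with
      | mem a ha => exact ⟨0, F.zero_mem, a, ha, by simp⟩
      | zero => exact ⟨0, F.zero_mem, 0, F.zero_mem, by simp⟩
      | add a b _ _ iha ihb =>
        obtain ⟨c, hc, d, hd, h1⟩ := iha
        obtain ⟨e, he, f, hf, h2⟩ := ihb
        exact ⟨c + e, F.add_mem hc he, d + f, F.add_mem hd hf, by rw [← h1, ← h2]; abel⟩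
      | neg a _ iha =>
        obtain ⟨c, hc, d, hd, h1⟩ := iha
        exact ⟨d, hd, c, hc, by rw [← h1]; abel⟩
    obtain ⟨a, ha, b, hb, hab⟩ := hdiff _ hxz
    have : x + z + a ∈ p := by
      rw [add_comm]; exact hp.add_mem a ((hFm a).1 ha).1 _ hxz'
    exact ((hFm b).1 hb).2 (hab ▸ this)

/-- If `F` is the face of `P` cut out by `w`, the dual of `F` is obtained from the dual of `P` by
adjoining `-w`. -/
lemma exists_add_nsmul_mem_dual {F P : AddSubmonoid G} (hP : P.FG)
    {w : Module.Dual ℤ G} (hw : w ∈ dual P) (hwF : ∀ x ∈ P, w x = 0 ↔ x ∈ F)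
    {σ : Module.Dual ℤ G} (hσ : σ ∈ dual F) : ∃ n : ℕ, σ + n • w ∈ dual P := by
  obtain ⟨S, hS⟩ := hP
  have hSP : ∀ x ∈ S, x ∈ P := fun x hx => hS ▸ AddSubmonoid.subset_closure hx
  refine ⟨∑ x ∈ S, (σ x).natAbs, fun x hx => ?_⟩
  rw [← hS] at hx
  induction hx using AddSubmonoid.closure_induction with
  | mem a ha =>
    have hwa : 0 ≤ w a := hw a (hSP a ha)
    simp only [LinearMap.add_apply, LinearMap.smul_apply, nsmul_eq_mul]
    rcases hwa.eq_or_lt with h0 | h0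
    · have := hσ a ((hwF a (hSP a ha)).1 h0.symm)
      simpa [← h0] using this
    · have h1 : (σ a).natAbs ≤ ∑ x ∈ S, (σ x).natAbs :=
        Finset.single_le_sum (f := fun x => (σ x).natAbs) (fun _ _ => Nat.zero_le _) ha
      have h2 : ((σ a).natAbs : ℤ) ≤ ((∑ x ∈ S, (σ x).natAbs : ℕ) : ℤ) := by exact_mod_cast h1
      have h3 : -(σ a) ≤ ((σ a).natAbs : ℤ) := by omega
      nlinarith
  | zero => simp
  | add a b _ _ ha hb => rw [map_add]; exact add_nonneg ha hb

end Separation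


section Chart

variable {G : Type u} [AddCommGroup G] (R : Type u) [CommRing R]

/-- The ring homomorphism `R[dual Q] → R[dual P]` for `P ≤ Q`, as an `R`-algebra homomorphism. -/
noncomputable def restrict {P Q : AddSubmonoid G} (h : P ≤ Q) :
    AddMonoidAlgebra R (dual Q) →ₐ[R] AddMonoidAlgebra R (dual P) :=
  AddMonoidAlgebra.mapDomainAlgHom R R (AddSubmonoid.inclusion (dual_anti h))

lemma restrict_single {P Q : AddSubmonoid G} (h : P ≤ Q) (σ : dual Q) (r : R) :
    restrict R h (AddMonoidAlgebra.single σ r) =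
      AddMonoidAlgebra.single (AddSubmonoid.inclusion (dual_anti h) σ) r := by
  simp [restrict]

lemma restrict_injective {P Q : AddSubmonoid G} (h : P ≤ Q) :
    Function.Injective (restrict R h) :=
  AddMonoidAlgebra.mapDomain_injective (AddSubmonoid.inclusion_injective (dual_anti h))

lemma isLocalization_away {F P : AddSubmonoid G} (hFP : F ≤ P) (hP : P.FG)
    (w : dual P) (hwF : ∀ x ∈ P, w.1 x = 0 ↔ x ∈ F) :
    letI := (restrict R hFP).toRingHom.toAlgebra
    IsLocalization.Away (AddMonoidAlgebra.single w 1 : AddMonoidAlgebra R (dual P))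
      (AddMonoidAlgebra R (dual F)) := by
  let := (restrict R hFP).toRingHom.toAlgebra
  have hmap : ∀ z, algebraMap (AddMonoidAlgebra R (dual P)) (AddMonoidAlgebra R (dual F)) z =
    restrict R hFP z := fun z => rfl
  have hneg : -w.1 ∈ dual F := fun x hx => by
    simp [(hwF x (hFP hx)).2 hx]
  have hunit : IsUnit (algebraMap (AddMonoidAlgebra R (dual P)) (AddMonoidAlgebra R (dual F))
      (AddMonoidAlgebra.single w 1)) := by
    refine IsUnit.of_mul_eq_one (AddMonoidAlgebra.single ⟨-w.1, hneg⟩ 1) ?_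
    rw [hmap, restrict_single, AddMonoidAlgebra.single_mul_single, AddMonoidAlgebra.one_def]
    congr 1
    · ext x; simp
    · simp
  refine ⟨?_, ?_, ?_⟩
  · rintro ⟨_, n, rfl⟩
    change IsUnit (algebraMap _ _ (AddMonoidAlgebra.single w 1 ^ n))
    rw [map_pow]; exact hunit.pow n
  · intro z
    suffices h : ∃ (n : ℕ) (y : AddMonoidAlgebra R (dual P)),
        z * restrict R hFP (AddMonoidAlgebra.single w 1) ^ n = restrict R hFP y by
      obtain ⟨n, y, h⟩ := h
      refine ⟨⟨y, ⟨_, n, rfl⟩⟩, ?_⟩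
      change z * restrict R hFP (AddMonoidAlgebra.single w 1 ^ n) = restrict R hFP y
      rw [map_pow]; exact h
    induction z using AddMonoidAlgebra.induction_linear with
    | zero => exact ⟨0, 0, by simp⟩
    | add a b ha hb =>
      obtain ⟨n, y, hy⟩ := ha
      obtain ⟨m, z, hz⟩ := hb
      refine ⟨n + m, y * AddMonoidAlgebra.single w 1 ^ m + z * AddMonoidAlgebra.single w 1 ^ n, ?_⟩
      rw [map_add, map_mul, map_mul, map_pow, map_pow, ← hy, ← hz]
      ring
    | single σ r =>
      obtain ⟨n, hn⟩ := exists_add_nsmul_mem_dual hP w.2 hwF σ.2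
      refine ⟨n, AddMonoidAlgebra.single ⟨_, hn⟩ r, ?_⟩
      rw [restrict_single, restrict_single, AddMonoidAlgebra.single_pow,
        AddMonoidAlgebra.single_mul_single]
      congr 1
      simp
  · intro a b hab
    exact ⟨1, by rw [restrict_injective R hFP hab]⟩

end Chart

section Scheme

open CategoryTheory CategoryTheory.Limits AlgebraicGeometry

variable {G : Type u} [AddCommGroup G] (R : Type u) [CommRing R]

/-- The affine chart `Spec R[dual P]`. -/
noncomputable abbrev chart (P : AddSubmonoid G) : Scheme.{u} :=
  Spec (CommRingCat.of (AddMonoidAlgebra R (dual P)))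

/-- The morphism `chart R P ⟶ chart R Q` for `P ≤ Q`. -/
noncomputable def chartMap {P Q : AddSubmonoid G} (h : P ≤ Q) : chart R P ⟶ chart R Q :=
  Spec.map (CommRingCat.ofHom (restrict R h).toRingHom)

/-- The structure morphism of a chart. -/
noncomputable def chartStr (P : AddSubmonoid G) : chart R P ⟶ Spec (CommRingCat.of R) :=
  Spec.map (CommRingCat.ofHom (algebraMap R (AddMonoidAlgebra R (dual P))))

lemma chartMap_refl (P : AddSubmonoid G) : chartMap R (le_refl P) = 𝟙 _ := by
  have : (restrict R (le_refl P)).toRingHom = RingHom.id _ := by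
    refine congrArg AlgHom.toRingHom (?_ : restrict R (le_refl P) = AlgHom.id R _)
    exact AddMonoidAlgebra.mapDomainAlgHom_id
  rw [chartMap, this, CommRingCat.ofHom_id, Spec.map_id]

lemma chartMap_comp {P Q T : AddSubmonoid G} (h : P ≤ Q) (h' : Q ≤ T) :
    chartMap R h ≫ chartMap R h' = chartMap R (h.trans h') := by
  have : (restrict R (h.trans h')).toRingHom =
      (restrict R h).toRingHom.comp (restrict R h').toRingHom := by
    refine congrArg AlgHom.toRingHom
      (?_ : restrict R (h.trans h') = (restrict R h).comp (restrict R h'))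
    exact AddMonoidAlgebra.mapDomainAlgHom_comp
      (AddSubmonoid.inclusion (dual_anti h')) (AddSubmonoid.inclusion (dual_anti h))
  rw [chartMap, chartMap, chartMap, this, CommRingCat.ofHom_comp, Spec.map_comp]

lemma chartMap_chartStr {P Q : AddSubmonoid G} (h : P ≤ Q) :
    chartMap R h ≫ chartStr R Q = chartStr R P := by
  rw [chartMap, chartStr, chartStr, ← Spec.map_comp, ← CommRingCat.ofHom_comp]
  congr 2
  exact (restrict R h).comp_algebraMap

lemma chartMap_isOpenImmersion {F P : AddSubmonoid G} (hFP : F ≤ P) (hP : P.FG)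
    {w : Module.Dual ℤ G} (hw : w ∈ dual P) (hwF : ∀ x ∈ P, w x = 0 ↔ x ∈ F) :
    IsOpenImmersion (chartMap R hFP) := by
  let := (restrict R hFP).toRingHom.toAlgebra
  have := isLocalization_away R hFP hP ⟨w, hw⟩ hwF
  exact IsOpenImmersion.of_isLocalization (S := AddMonoidAlgebra R (dual F))
    (AddMonoidAlgebra.single ⟨w, hw⟩ 1 : AddMonoidAlgebra R (dual P))

lemma range_chartMap {F P : AddSubmonoid G} (hFP : F ≤ P) (hP : P.FG)
    (w : dual P) (hwF : ∀ x ∈ P, w.1 x = 0 ↔ x ∈ F) :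
    Set.range (chartMap R hFP) = (PrimeSpectrum.basicOpen
      (AddMonoidAlgebra.single w 1 : AddMonoidAlgebra R (dual P)) : Set (PrimeSpectrum _)) := by
  let := (restrict R hFP).toRingHom.toAlgebra
  have := isLocalization_away R hFP hP w hwF
  exact PrimeSpectrum.localization_away_comap_range (AddMonoidAlgebra R (dual F))
    (AddMonoidAlgebra.single w 1 : AddMonoidAlgebra R (dual P))

variable (D : Fan G)

/-- The charts of the cones of a fan, ordered by inclusion of cones. -/
noncomputable def diagram : D.cones ⥤ Scheme.{u} where
  obj P := chart R P.1
  map f := chartMap R (leOfHom f)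
  map_id P := chartMap_refl R P.1
  map_comp _ _ := (chartMap_comp R _ _).symm

lemma Fan.isPrimeCompl {P Q : AddSubmonoid G} (hP : P ∈ D.cones) (hQ : Q ∈ D.cones) (h : P ≤ Q) :
    IsPrimeCompl P Q := by
  have := (D.inter P hP Q hQ).2
  rwa [inf_eq_left.2 h] at this

lemma Fan.inf_mem {P Q : AddSubmonoid G} (hP : P ∈ D.cones) (hQ : Q ∈ D.cones) :
    P ⊓ Q ∈ D.cones :=
  D.primeCompl_mem P hP _ (D.inter P hP Q hQ).1

variable [Module.Finite ℤ G]

instance {P Q : D.cones} (f : P ⟶ Q) : IsOpenImmersion ((diagram R D).map f) := by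
  obtain ⟨w, hw, hwF⟩ := exists_support (D.isConvexCone Q Q.2).fg
    (D.isPrimeCompl P.2 Q.2 (leOfHom f))
  exact chartMap_isOpenImmersion R _ (D.isConvexCone Q Q.2).fg hw hwF

instance : (diagram R D ⋙ Scheme.forget).IsLocallyDirected where
  cond {P Q T} f g x y hxy := by
    have hT := (D.isConvexCone T T.2).fg
    obtain ⟨v, hv, hvF⟩ := exists_support hT (D.isPrimeCompl P.2 T.2 (leOfHom f))
    obtain ⟨w, hw, hwF⟩ := exists_support hT (D.isPrimeCompl Q.2 T.2 (leOfHom g))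
    let L : D.cones := ⟨P.1 ⊓ Q.1, D.inf_mem P.2 Q.2⟩
    let lP : L ⟶ P := homOfLE (show P.1 ⊓ Q.1 ≤ P.1 from inf_le_left)
    let lQ : L ⟶ Q := homOfLE (show P.1 ⊓ Q.1 ≤ Q.1 from inf_le_right)
    have hvw : ∀ x ∈ T.1, (v + w) x = 0 ↔ x ∈ L.1 := fun x hx => by
      have h1 := hv x hx
      have h2 := hw x hx
      rw [AddSubmonoid.mem_inf, ← hvF x hx, ← hwF x hx, LinearMap.add_apply]
      omega
    have e1 := range_chartMap R (leOfHom f) hT ⟨v, hv⟩ hvF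
    have e2 := range_chartMap R (leOfHom g) hT ⟨w, hw⟩ hwF
    have e3 := range_chartMap R (leOfHom (lP ≫ f)) hT (⟨v, hv⟩ + ⟨w, hw⟩) hvw
    have hx : (diagram R D).map f x ∈ Set.range (chartMap R (leOfHom (lP ≫ f))) := by
      rw [e3, ← one_mul (1 : R), ← AddMonoidAlgebra.single_mul_single,
        PrimeSpectrum.basicOpen_mul]
      refine ⟨?_, ?_⟩
      · rw [← e1]; exact ⟨x, rfl⟩
      · rw [← e2]; exact ⟨y, hxy.symm⟩
    obtain ⟨z, hz⟩ := hx
    have hz' : (diagram R D).map (lP ≫ f) z = (diagram R D).map f x := hz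
    refine ⟨L, lP, lQ, z, ?_, ?_⟩
    · apply ((diagram R D).map f).isOpenEmbedding.injective
      rw [← hz', Functor.map_comp]; rfl
    · apply ((diagram R D).map g).isOpenEmbedding.injective
      have : lP ≫ f = lQ ≫ g := Subsingleton.elim _ _
      refine Eq.trans ?_ (hz'.trans hxy)
      rw [this, Functor.map_comp]; rfl

/-- The toric scheme of a fan over `R`. The diagram consists of open immersions and is locally
directed, so that the colimit is the gluing of the charts of all cones `P` and `Q` along the chart
of `P ⊓ Q`. -/
noncomputable def toricScheme : Scheme.{u} := colimit (diagram R D)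

/-- The structure morphism of the toric scheme. -/
noncomputable def toricStr : toricScheme R D ⟶ Spec (CommRingCat.of R) :=
  colimit.desc (diagram R D)
    { pt := Spec (CommRingCat.of R)
      ι := { app := fun P => chartStr R P.1
             naturality := fun _ _ f => (chartMap_chartStr R (leOfHom f)).trans
              (Category.comp_id _).symm } }

/-- The inclusion of the chart of `P` in the toric scheme. -/
noncomputable def chartι (P : D.cones) : chart R P.1 ⟶ toricScheme R D :=
  colimit.ι (diagram R D) P

instance (P : D.cones) : IsOpenImmersion (chartι R D P) :=
  inferInstanceAs (IsOpenImmersion (colimit.ι (diagram R D) P))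

lemma chartι_toricStr (P : D.cones) : chartι R D P ≫ toricStr R D = chartStr R P.1 :=
  colimit.ι_desc _ _

lemma chartι_jointly_surjective (x : toricScheme R D) : ∃ P, x ∈ Set.range (chartι R D P) :=
  Scheme.IsLocallyDirected.ι_jointly_surjective (diagram R D) x

/-- The charts of `P` and `Q` intersect in the chart of `P ⊓ Q`. -/
lemma range_chartι_inter (P Q : D.cones) :
    Set.range (chartι R D P) ∩ Set.range (chartι R D Q) =
      Set.range (chartι R D ⟨P.1 ⊓ Q.1, D.inf_mem P.2 Q.2⟩) := by
  let L : D.cones := ⟨P.1 ⊓ Q.1, D.inf_mem P.2 Q.2⟩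
  let lP : L ⟶ P := homOfLE (show P.1 ⊓ Q.1 ≤ P.1 from inf_le_left)
  let lQ : L ⟶ Q := homOfLE (show P.1 ⊓ Q.1 ≤ Q.1 from inf_le_right)
  ext t
  constructor
  · rintro ⟨⟨x, rfl⟩, ⟨y, hy⟩⟩
    obtain ⟨k, f, g, z, rfl, hz⟩ := (Scheme.IsLocallyDirected.ι_eq_ι_iff (diagram R D)).1 hy.symm
    have hk : k ⟶ L := homOfLE (le_inf (leOfHom f) (leOfHom g) : k.1 ≤ P.1 ⊓ Q.1)
    refine ⟨(diagram R D).map hk z, ?_⟩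
    have h1 := colimit.w (diagram R D) hk
    have h2 := colimit.w (diagram R D) f
    exact congr($(h1.trans h2.symm) z)
  · rintro ⟨z, rfl⟩
    exact ⟨⟨(diagram R D).map lP z, congr($(colimit.w (diagram R D) lP) z)⟩,
      ⟨(diagram R D).map lQ z, congr($(colimit.w (diagram R D) lQ) z)⟩⟩

end Scheme

end Toric

/-!
The diagonal of `X = toricScheme R D` over `R` can be tested on the open subschemes
`U_P ×[R] U_Q` of `X ×[R] X`, for cones `P` and `Q` of the fan. Over such an open subscheme the
diagonal is the morphism `U_{P ∩ Q} ⟶ U_P ×[R] U_Q` of affine schemes, so it is a closed immersion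
as soon as `R[dual P] ⊗ R[dual Q] → R[dual (P ⊓ Q)]` is surjective.

Surjectivity comes from the separation lemma `exists_separating`: some linear form `w` is
nonnegative on `P`, nonpositive on `Q`, and vanishes on `P` exactly along the common face `P ⊓ Q`.
It exists by Gordan's alternative, applied to the generators of `P` outside `Q` and the negatives
of the generators of `Q` outside `P`, modulo the group generated by `P ⊓ Q`; the other
alternative contradicts that `P ⊓ Q` is a face of both cones. For `σ` in the dual of `P ⊓ Q` some
`σ + n • w` lies in `dual P`, while `-(n • w)` lies in `dual Q`, so `dual (P ⊓ Q)` is the sum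
`dual P + dual Q`, and every monomial of `R[dual (P ⊓ Q)]` is a product of one from each chart.
-/

namespace Toric

/-! ### Separation of two cones along their common face -/

section SeparationLemma

variable {G : Type u} [AddCommGroup G]

/-- The complement of a prime ideal of `P` is a face: it contains the summands in `P` of each of
its elements. -/
lemma IsPrimeCompl.mem_of_add_mem {F P : AddSubmonoid G} (h : IsPrimeCompl F P) {x y : G}
    (hx : x ∈ P) (hy : y ∈ P) (hxy : x + y ∈ F) : x ∈ F := by
  obtain ⟨p, hp, hF⟩ := h
  have hF' : ∀ z, z ∈ F ↔ z ∈ P ∧ z ∉ p := fun z => by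
    rw [← SetLike.mem_coe, hF]; simp
  refine (hF' x).2 ⟨hx, fun hxp => ((hF' _).1 hxy).2 ?_⟩
  rw [add_comm]
  exact hp.add_mem y hy x hxp

lemma exists_add_eq_of_mem_gp {F : AddSubmonoid G} {g : G} (hg : g ∈ gp F) :
    ∃ a ∈ F, ∃ b ∈ F, g + a = b := by
  induction hg using AddSubgroup.closure_induction with
  | mem a ha => exact ⟨0, F.zero_mem, a, ha, by simp⟩
  | zero => exact ⟨0, F.zero_mem, 0, F.zero_mem, by simp⟩
  | add a b _ _ iha ihb =>
    obtain ⟨c, hc, d, hd, h1⟩ := iha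
    obtain ⟨e, he, f, hf, h2⟩ := ihb
    exact ⟨c + e, F.add_mem hc he, d + f, F.add_mem hd hf, by rw [← h1, ← h2]; abel⟩
  | neg a _ iha =>
    obtain ⟨c, hc, d, hd, h1⟩ := iha
    exact ⟨d, hd, c, hc, by rw [← h1]; abel⟩

/-- If `P ⊓ Q` is a face of both `P` and `Q`, then a difference `p - q` of elements of `P` and `Q`
lies in the group generated by `P ⊓ Q` only if both `p` and `q` lie in `P ⊓ Q`. -/
lemma mem_inf_of_sub_mem_gp {P Q : AddSubmonoid G} (hP : IsPrimeCompl (P ⊓ Q) P)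
    (hQ : IsPrimeCompl (P ⊓ Q) Q) {p q : G} (hp : p ∈ P) (hq : q ∈ Q)
    (h : p - q ∈ gp (P ⊓ Q)) : p ∈ P ⊓ Q ∧ q ∈ P ⊓ Q := by
  obtain ⟨a, ha, b, hb, hab⟩ := exists_add_eq_of_mem_gp h
  have hpq : p + a = q + b := by rw [← hab]; abel
  have hmem : p + a ∈ P ⊓ Q :=
    AddSubmonoid.mem_inf.2 ⟨P.add_mem hp ha.1, hpq ▸ Q.add_mem hq hb.2⟩
  exact ⟨hP.mem_of_add_mem hp ha.1 hmem, hQ.mem_of_add_mem hq hb.2 (hpq ▸ hmem)⟩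

/-- Two cones meeting in a common face are separated by a linear form which vanishes on the first
cone exactly along that face. -/
lemma exists_separating [Module.Finite ℤ G] {P Q : AddSubmonoid G} (hPfg : P.FG) (hQfg : Q.FG)
    (hP : IsPrimeCompl (P ⊓ Q) P) (hQ : IsPrimeCompl (P ⊓ Q) Q) :
    ∃ w ∈ dual P, -w ∈ dual Q ∧ ∀ x ∈ P, w x = 0 ↔ x ∈ P ⊓ Q := by
  classical
  obtain ⟨S, hS⟩ := hPfg
  obtain ⟨T, hT⟩ := hQfg
  have hSP : ∀ x ∈ S, x ∈ P := fun x hx => hS ▸ AddSubmonoid.subset_closure hx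
  have hTQ : ∀ x ∈ T, x ∈ Q := fun x hx => hT ▸ AddSubmonoid.subset_closure hx
  let A := S.filter (· ∉ Q)
  let B := (T.filter (· ∉ P)).image (-·)
  rcases gordan (A ∪ B) (gp (P ⊓ Q)) with ⟨w, hwK, hw⟩ | ⟨x, hx, z, hz, hxz⟩
  · have hwF : ∀ x ∈ P ⊓ Q, w x = 0 := fun x hx => hwK x (AddSubgroup.subset_closure hx)
    have key : ∀ x ∈ P, 0 ≤ w x ∧ (w x = 0 → x ∈ P ⊓ Q) := by
      intro x hx
      rw [← hS] at hx
      induction hx using AddSubmonoid.closure_induction with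
      | mem a ha =>
        by_cases haQ : a ∈ Q
        · have haF : a ∈ P ⊓ Q := ⟨hSP a ha, haQ⟩
          exact ⟨(hwF a haF).ge, fun _ => haF⟩
        · have := hw a (Finset.mem_union_left _ (Finset.mem_filter.2 ⟨ha, haQ⟩))
          exact ⟨this.le, fun h => absurd h this.ne'⟩
      | zero => exact ⟨by simp, fun _ => zero_mem _⟩
      | add a b _ _ iha ihb =>
        rw [map_add]
        exact ⟨add_nonneg iha.1 ihb.1, fun h =>
          add_mem (iha.2 (by linarith [iha.1, ihb.1])) (ihb.2 (by linarith [iha.1, ihb.1]))⟩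
    refine ⟨w, fun x hx => (key x hx).1, fun x hx => ?_,
      fun x hx => ⟨(key x hx).2, hwF x⟩⟩
    rw [← hT] at hx
    induction hx using AddSubmonoid.closure_induction with
    | mem a ha =>
      by_cases haP : a ∈ P
      · simp [hwF a ⟨haP, hTQ a ha⟩]
      · have := hw (-a) (Finset.mem_union_right _
          (Finset.mem_image_of_mem _ (Finset.mem_filter.2 ⟨ha, haP⟩)))
        rw [map_neg] at this
        exact this.le
    | zero => simp
    | add a b _ _ iha ihb => rw [map_add]; exact add_nonneg iha ihb
  · exfalso
    -- The elements of the monoid generated by `A` and `B` are differences `p - q`, so Gordan's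
    -- relation is `p' - q' ∈ gp (P ⊓ Q)` with `x` a summand of `p'` or `-x` a summand of `q'`.
    have hz' : ∃ p ∈ P, ∃ q ∈ Q, z = p - q := by
      clear hxz
      induction hz using AddSubmonoid.closure_induction with
      | mem a ha =>
        rcases Finset.mem_union.1 ha with ha | ha
        · exact ⟨a, hSP a (Finset.mem_filter.1 ha).1, 0, Q.zero_mem, by simp⟩
        · obtain ⟨b, hb, rfl⟩ := Finset.mem_image.1 ha
          exact ⟨0, P.zero_mem, b, hTQ b (Finset.mem_filter.1 hb).1, by simp⟩
      | zero => exact ⟨0, P.zero_mem, 0, Q.zero_mem, by simp⟩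
      | add a b _ _ iha ihb =>
        obtain ⟨p, hp, q, hq, rfl⟩ := iha
        obtain ⟨p', hp', q', hq', rfl⟩ := ihb
        exact ⟨p + p', P.add_mem hp hp', q + q', Q.add_mem hq hq', by abel⟩
    obtain ⟨p, hp, q, hq, rfl⟩ := hz'
    rcases Finset.mem_union.1 hx with hx | hx
    · obtain ⟨hxS, hxQ⟩ := Finset.mem_filter.1 hx
      have hxP := hSP x hxS
      rw [← add_sub_assoc] at hxz
      have h := (mem_inf_of_sub_mem_gp hP hQ (P.add_mem hxP hp) hq hxz).1
      exact hxQ (hP.mem_of_add_mem hxP hp h).2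
    · obtain ⟨y, hy, rfl⟩ := Finset.mem_image.1 hx
      obtain ⟨hyT, hyP⟩ := Finset.mem_filter.1 hy
      have hyQ := hTQ y hyT
      rw [show -y + (p - q) = p - (y + q) by abel] at hxz
      have h := (mem_inf_of_sub_mem_gp hP hQ hp (Q.add_mem hyQ hq) hxz).2
      exact hyP (hQ.mem_of_add_mem hyQ hq h).1

/-- The dual of the common face of two cones is the sum of their duals: with a separating form `w`,
`σ = (σ + n • w) + n • (-w)` for large `n`. -/
lemma dual_inf_le_sup [Module.Finite ℤ G] {P Q : AddSubmonoid G} (hPfg : P.FG) (hQfg : Q.FG)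
    (hP : IsPrimeCompl (P ⊓ Q) P) (hQ : IsPrimeCompl (P ⊓ Q) Q) :
    dual (P ⊓ Q) ≤ dual P ⊔ dual Q := by
  obtain ⟨w, hw, hwQ, hwF⟩ := exists_separating hPfg hQfg hP hQ
  intro σ hσ
  obtain ⟨n, hn⟩ := exists_add_nsmul_mem_dual hPfg hw hwF hσ
  exact AddSubmonoid.mem_sup.2 ⟨_, hn, _, AddSubmonoid.nsmul_mem _ hwQ n, by simp⟩

end SeparationLemma

/-! ### The map `R[dual P] ⊗ R[dual Q] → R[dual (P ⊓ Q)]` -/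

section Surjectivity

open scoped TensorProduct

variable {G : Type u} [AddCommGroup G] (R : Type u) [CommRing R]

lemma lift_restrict_surjective {F P Q : AddSubmonoid G} (hFP : F ≤ P) (hFQ : F ≤ Q)
    (h : dual F ≤ dual P ⊔ dual Q) :
    Function.Surjective (Algebra.TensorProduct.lift (restrict R hFP) (restrict R hFQ)
      (fun _ _ => .all _ _)) := by
  intro z
  induction z using AddMonoidAlgebra.induction_linear with
  | zero => exact ⟨0, map_zero _⟩
  | add a b ha hb =>
    obtain ⟨x, rfl⟩ := ha
    obtain ⟨y, rfl⟩ := hb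
    exact ⟨x + y, map_add _ _ _⟩
  | single σ r =>
    obtain ⟨α, hα, β, hβ, hαβ⟩ := AddSubmonoid.mem_sup.1 (h σ.2)
    refine ⟨AddMonoidAlgebra.single ⟨α, hα⟩ r ⊗ₜ AddMonoidAlgebra.single ⟨β, hβ⟩ 1, ?_⟩
    rw [Algebra.TensorProduct.lift_tmul, restrict_single, restrict_single,
      AddMonoidAlgebra.single_mul_single, mul_one]
    congr 1
    exact Subtype.ext hαβ

end Surjectivity

open CategoryTheory CategoryTheory.Limits AlgebraicGeometry

/-! ### Closedness of the diagonal on an open cover -/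

section Diagonal

/-- Separatedness can be tested on an open cover: it suffices that the intersections
`W i j = U i ∩ U j` are closed in the products `U i ×[S] U j`. -/
lemma isSeparated_of_openCover {X S : Scheme.{u}} (f : X ⟶ S) (𝒰 : X.OpenCover)
    (s : ∀ i, 𝒰.X i ⟶ S) (hs : ∀ i, 𝒰.f i ≫ f = s i) (W : 𝒰.I₀ → 𝒰.I₀ → Scheme.{u})
    (p : ∀ i j, W i j ⟶ 𝒰.X i) (q : ∀ i j, W i j ⟶ 𝒰.X j)
    (hW : ∀ i j, IsPullback (p i j) (q i j) (𝒰.f i) (𝒰.f j))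
    (hpq : ∀ i j, p i j ≫ s i = q i j ≫ s j)
    (h : ∀ i j, IsClosedImmersion (pullback.lift (p i j) (q i j) (hpq i j))) :
    IsSeparated f := by
  obtain rfl : s = fun i => 𝒰.f i ≫ f := funext fun i => (hs i).symm
  refine ⟨IsZariskiLocalAtTarget.of_openCover
    (Scheme.Pullback.openCoverOfLeftRight 𝒰 𝒰 f f) ?_⟩
  rintro ⟨i, j⟩
  -- The base change of the diagonal to `U i ×[S] U j` is `U i ×[X] U j`, that is, `W i j`.
  change IsClosedImmersion (pullback.snd (pullback.diagonal f)
    (pullback.map (𝒰.f i ≫ f) (𝒰.f j ≫ f) f f (𝒰.f i) (𝒰.f j) (𝟙 S)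
      (Category.comp_id _) (Category.comp_id _)))
  rw [← MorphismProperty.cancel_left_of_respectsIso (P := @IsClosedImmersion)
    ((hW i j).isoPullback.hom ≫ (pullbackDiagonalMapIdIso (𝒰.f i) (𝒰.f j) f).inv)]
  convert! h i j using 1
  apply pullback.hom_ext
  · rw [pullback.lift_fst, Category.assoc, Category.assoc,
      pullbackDiagonalMapIdIso_inv_snd_fst, (hW i j).isoPullback_hom_fst]
  · rw [pullback.lift_snd, Category.assoc, Category.assoc,
      pullbackDiagonalMapIdIso_inv_snd_snd, (hW i j).isoPullback_hom_snd]

open scoped TensorProduct in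
lemma isClosedImmersion_lift_specMap {R A B C : Type u} [CommRing R] [CommRing A] [CommRing B]
    [CommRing C] [Algebra R A] [Algebra R B] [Algebra R C] (φ : A →ₐ[R] C) (ψ : B →ₐ[R] C)
    (h : Function.Surjective (Algebra.TensorProduct.lift φ ψ (fun _ _ => .all _ _)))
    (H : Spec.map (CommRingCat.ofHom φ.toRingHom) ≫
        Spec.map (CommRingCat.ofHom (algebraMap R A)) =
      Spec.map (CommRingCat.ofHom ψ.toRingHom) ≫ Spec.map (CommRingCat.ofHom (algebraMap R B))) :
    IsClosedImmersion (pullback.lift (Spec.map (CommRingCat.ofHom φ.toRingHom))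
      (Spec.map (CommRingCat.ofHom ψ.toRingHom)) H) := by
  let F : A ⊗[R] B →+* C := (Algebra.TensorProduct.lift φ ψ (fun _ _ => .all _ _)).toRingHom
  have key : pullback.lift (Spec.map (CommRingCat.ofHom φ.toRingHom))
      (Spec.map (CommRingCat.ofHom ψ.toRingHom)) H =
      Spec.map (CommRingCat.ofHom F) ≫ (pullbackSpecIso R A B).inv := by
    apply pullback.hom_ext
    · rw [pullback.lift_fst, Category.assoc, pullbackSpecIso_inv_fst, ← Spec.map_comp,
        ← CommRingCat.ofHom_comp]
      congr 2
      ext x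
      simp [F]
    · rw [pullback.lift_snd, Category.assoc, pullbackSpecIso_inv_snd, ← Spec.map_comp,
        ← CommRingCat.ofHom_comp]
      congr 2
      ext x
      simp [F]
  have := IsClosedImmersion.spec_of_surjective (CommRingCat.ofHom F) h
  rw [key, MorphismProperty.cancel_right_of_respectsIso (P := @IsClosedImmersion)]
  exact this

end Diagonal

/-! ### Intersections of charts and separatedness of the toric scheme -/

section Fan

variable {G : Type u} [AddCommGroup G] (R : Type u) [CommRing R] (D : Fan G)
  [Module.Finite ℤ G]

/-- The charts of `P` and `Q` meet in the chart of `P ⊓ Q`, as a fibre product of schemes. -/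
lemma isPullback_chartMap (P Q : D.cones) :
    IsPullback (chartMap R (inf_le_left : P.1 ⊓ Q.1 ≤ P.1))
      (chartMap R (inf_le_right : P.1 ⊓ Q.1 ≤ Q.1)) (chartι R D P) (chartι R D Q) := by
  let L : D.cones := ⟨P.1 ⊓ Q.1, D.inf_mem P.2 Q.2⟩
  let lP : L ⟶ P := homOfLE (show P.1 ⊓ Q.1 ≤ P.1 from inf_le_left)
  let lQ : L ⟶ Q := homOfLE (show P.1 ⊓ Q.1 ≤ Q.1 from inf_le_right)
  have hP : chartMap R (inf_le_left : P.1 ⊓ Q.1 ≤ P.1) ≫ chartι R D P = chartι R D L :=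
    colimit.w (diagram R D) lP
  have hQ : chartMap R (inf_le_right : P.1 ⊓ Q.1 ≤ Q.1) ≫ chartι R D Q = chartι R D L :=
    colimit.w (diagram R D) lQ
  have : IsOpenImmersion (chartMap R (inf_le_left : P.1 ⊓ Q.1 ≤ P.1)) :=
    inferInstanceAs (IsOpenImmersion ((diagram R D).map lP))
  refine (IsOpenImmersion.isPullback _ _ _ _ (hP.trans hQ.symm) ?_).flip
  ext x
  change chartι R D P x ∈ Set.range (chartι R D Q) ↔ x ∈ Set.range (chartMap R _)
  have hx : chartι R D P x ∈ Set.range (chartι R D Q) ↔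
      chartι R D P x ∈ Set.range (chartι R D L) := by
    rw [← range_chartι_inter]
    simp
  rw [hx, ← hP]
  constructor
  · rintro ⟨z, hz⟩
    exact ⟨z, (chartι R D P).isOpenEmbedding.injective hz⟩
  · rintro ⟨z, rfl⟩
    exact ⟨z, rfl⟩

theorem isSeparated_toricStr : IsSeparated (toricStr R D) := by
  refine isSeparated_of_openCover (toricStr R D)
    (Scheme.IsLocallyDirected.openCover (diagram R D)) (fun P : D.cones => chartStr R P.1)
    (fun P => chartι_toricStr R D P) (fun P Q : D.cones => chart R (P.1 ⊓ Q.1))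
    (fun P Q : D.cones => chartMap R inf_le_left) (fun P Q : D.cones => chartMap R inf_le_right)
    (fun P Q => isPullback_chartMap R D P Q)
    (fun P Q => (chartMap_chartStr R _).trans (chartMap_chartStr R _).symm) ?_
  intro (P : D.cones) (Q : D.cones)
  have hPQ := D.inter P P.2 Q Q.2
  exact isClosedImmersion_lift_specMap _ _ (lift_restrict_surjective R _ _
    (dual_inf_le_sup (D.isConvexCone P P.2).fg (D.isConvexCone Q Q.2).fg hPQ.1 hPQ.2)) _

end Fan

end Toric

theorem mainTheorem2 {G : Type u} [AddCommGroup G] [Module.Free ℤ G] [Module.Finite ℤ G]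
    (D : Toric.Fan G) (R : Type u) [CommRing R] :
    AlgebraicGeometry.IsSeparated (Toric.toricStr R D) :=
  Toric.isSeparated_toricStr R D
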